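/- Let $g>0$ and $B\ge e^{g}+e^{-g}$, let $\mu$ be a probability measure on $[-B,B]$, and let $(\omega_j)_{j\in\mathbb Z}$ be i.i.d. with distribution $\mu$. On $\ell^2(\mathbb Z)$ with canonical basis $(\varphi_j)$ consider, for $h\ge 0$, the bounded operator $$H_\omega(h)\varphi_j=e^{-h}\varphi_{j-1}+e^{h}\varphi_{j+1}+\omega_j\varphi_j ,$$ and set $s(g)=e^{g}+e^{-g}+B$, $T_\omega(g)=H_\omega(g)/s(g)$ (a contraction). For $f$ in the disc algebra $A(\mathbb D)$, with $f(z)=\sum_n c_nz^n$ on $\mathbb D$, let $f(T_\omega(g))$ be the strong limit of $\sum_n c_n r^n T_\omega(g)^n$ as $r\to1^-$, and let $$L^{(g)}(f)=\mathbb E\,\langle\varphi_0, f(T_\omega(g))\varphi_0\rangle$$ be the density of states functional. Let $dk$ be the density of states of the self-adjoint Anderson model $H_\omega(0)$, i.e. the unique locally finite Borel measure on $\mathbb R$ with $\int f\,dk=\mathbb E\langle\varphi_0,f(H_\omega(0))\varphi_0\rangle$ for all continuous compactly supported $f:\mathbb R\to\mathbb R$; it exists. There is a function $\psi^{(g)}$,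 holomorphic on $\{|z|<s(g)/(2+B)\}$ (a disc of radius $>1$), such that $$L^{(g)}(f)=\int_0^{2\pi}f(e^{it})\,\overline{\psi^{(g)}(e^{it})}\,\frac{dt}{2\pi}\qquad\text{for all } f\in A(\mathbb D).$$ Moreover, whenever $0<r<1$ and $\psi^{(g)}$ is holomorphic on $\{|z|<1/r\}$ and represents $L^{(g)}$ in this way: (i) there is a power series $\sum_n b_nz^n$ with real coefficients which converges for all $|z|<s(g)/(2+B)$ and has sum $\psi^{(g)}(z)$ for all such $z$ with $|z|<1/r$; (ii) $\psi^{(g)}$ admits an analytic continuation to $\mathbb C\setminus\left(\left]-\infty,-\tfrac{s(g)}{2+B}\right]\cup\left[\tfrac{s(g)}{2+B},\infty\right[\right)$ (agreeing with $\psi^{(g)}$ at all points of this set with $|z|<1/r$), given by the convergent integral $$\psi^{(g)}(z)=\int_{[-(2+B),\,2+B]}\frac{dk(x)}{1-zx/s(g)} .$$ -/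

import Mathlib

open MeasureTheory Filter Topology
open scoped ComplexConjugate

noncomputable section

namespace NSAnderson

/-- The Hilbert space `ℓ²(ℤ)` over `ℂ`. -/
abbrev EllTwo : Type := lp (fun _ : ℤ => ℂ) 2

/-- The canonical basis vector `φ_j` of `ℓ²(ℤ)`. -/
def basisVec (j : ℤ) : EllTwo := lp.single 2 j 1

theorem memlp_iff (u : ∀ _ : ℤ, ℂ) :
    Memℓp (E := fun _ : ℤ => ℂ) u 2 ↔ Summable fun k => ‖u k‖ ^ (2 : ℝ) := by
  rw [memℓp_gen_iff (by norm_num)]; simp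

theorem norm_rpow_two (u : EllTwo) : ‖u‖ ^ (2 : ℝ) = ∑' k, ‖u k‖ ^ (2 : ℝ) := by
  simpa using lp.norm_rpow_eq_tsum (E := fun _ : ℤ => ℂ) (p := 2) (by norm_num) u

theorem summable_coord (u : EllTwo) : Summable fun k => ‖u k‖ ^ (2 : ℝ) :=
  (memlp_iff _).1 (lp.memℓp u)

/-- The translation `(shift m u)(k) = u(k - m)`, that is `φ_j ↦ φ_{j+m}`. -/
def shift (m : ℤ) : EllTwo →L[ℂ] EllTwo :=
  LinearMap.mkContinuous
    { toFun := fun u => ⟨fun k => u (k - m), (memlp_iff _).2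
        ((Equiv.subRight m).summable_iff.2 (summable_coord u))⟩
      map_add' := fun _ _ => rfl
      map_smul' := fun _ _ => rfl } 1
    (fun u => by
      rw [one_mul]
      refine (Real.rpow_le_rpow_iff (norm_nonneg _) (norm_nonneg _) two_pos).1 ?_
      rw [norm_rpow_two, norm_rpow_two]
      exact ((Equiv.subRight m).tsum_eq fun k => ‖u k‖ ^ (2 : ℝ)).le)

@[simp] theorem shift_apply (m : ℤ) (u : EllTwo) (k : ℤ) : shift m u k = u (k - m) := rfl

theorem norm_coord_le {B : ℝ} (ω : ℤ → Set.Icc (-B) B) (u : EllTwo) (k : ℤ) :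
    ‖((ω k : ℝ) : ℂ) * u k‖ ≤ ‖((B : ℂ) • u : EllTwo) k‖ := by
  have h : |(ω k : ℝ)| ≤ |B| := (abs_le.2 (ω k).2).trans (le_abs_self B)
  rw [lp.coeFn_smul, Pi.smul_apply, norm_mul, norm_smul, Complex.norm_real, Complex.norm_real]
  exact mul_le_mul_of_nonneg_right h (norm_nonneg _)

theorem memlp_mul {B : ℝ} (ω : ℤ → Set.Icc (-B) B) (u : EllTwo) :
    Memℓp (E := fun _ : ℤ => ℂ) (fun k => ((ω k : ℝ) : ℂ) * u k) 2 :=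
  (memlp_iff _).2 <| Summable.of_nonneg_of_le (fun _ => by positivity)
    (fun k => Real.rpow_le_rpow (norm_nonneg _) (norm_coord_le ω u k) zero_le_two)
    (summable_coord ((B : ℂ) • u))

/-- Multiplication by a real sequence with values in `[-B, B]`. -/
def potential {B : ℝ} (ω : ℤ → Set.Icc (-B) B) : EllTwo →L[ℂ] EllTwo :=
  LinearMap.mkContinuous
    { toFun := fun u => ⟨fun k => ((ω k : ℝ) : ℂ) * u k, memlp_mul ω u⟩
      map_add' := fun u v => by ext k; exact mul_add _ _ _
      map_smul' := fun c u => by ext k; exact mul_left_comm _ _ _ } |B|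
    (fun u => by
      have h : ‖((B : ℂ) • u : EllTwo)‖ = |B| * ‖u‖ := by
        rw [norm_smul, Complex.norm_real, Real.norm_eq_abs]
      rw [← h]
      refine (Real.rpow_le_rpow_iff (norm_nonneg _) (norm_nonneg _) two_pos).1 ?_
      rw [norm_rpow_two, norm_rpow_two]
      exact (summable_coord _).tsum_le_tsum
        (fun k => Real.rpow_le_rpow (norm_nonneg _) (norm_coord_le ω u k) zero_le_two)
        (summable_coord _))

@[simp] theorem potential_apply {B : ℝ} (ω : ℤ → Set.Icc (-B) B) (u : EllTwo) (k : ℤ) :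
    potential ω u k = ((ω k : ℝ) : ℂ) * u k := rfl

/-- The non-self-adjoint Anderson Hamiltonian,
`H_ω(g) φ_j = e^{-g} φ_{j-1} + e^{g} φ_{j+1} + ω_j φ_j`; for `g = 0` it is the self-adjoint
Anderson model. -/
def hamiltonian (g : ℝ) {B : ℝ} (ω : ℤ → Set.Icc (-B) B) : EllTwo →L[ℂ] EllTwo :=
  ((Real.exp (-g) : ℝ) : ℂ) • shift (-1) + ((Real.exp g : ℝ) : ℂ) • shift 1 + potential ω

theorem hamiltonian_basisVec (g : ℝ) {B : ℝ} (ω : ℤ → Set.Icc (-B) B) (j : ℤ) :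
    hamiltonian g ω (basisVec j) =
      ((Real.exp (-g) : ℝ) : ℂ) • basisVec (j - 1) + ((Real.exp g : ℝ) : ℂ) • basisVec (j + 1)
        + ((ω j : ℝ) : ℂ) • basisVec j := by
  have h1 : ∀ m : ℤ, shift m (basisVec j) = basisVec (j + m) := fun m => by
    ext k
    by_cases h : k - m = j
    · have h' : k = j + m := by omega
      subst h'
      simp [basisVec]
    · have h' : k ≠ j + m := by omega
      simp [basisVec, h, h']
  have h2 : potential ω (basisVec j) = ((ω j : ℝ) : ℂ) • basisVec j := by
    ext k
    by_cases h : k = j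
    · subst h
      rw [potential_apply, lp.coeFn_smul, Pi.smul_apply]
      simp [basisVec]
    · rw [potential_apply, lp.coeFn_smul, Pi.smul_apply]
      simp [basisVec, h]
  simp [hamiltonian, h1, h2, sub_eq_add_neg]

/-- The normalisation `s(g) = e^g + e^{-g} + B`. -/
def scale (g B : ℝ) : ℝ := Real.exp g + Real.exp (-g) + B

/-- The rescaled model `T_ω(g) = H_ω(g) / s(g)`. -/
def rescaled (g : ℝ) {B : ℝ} (ω : ℤ → Set.Icc (-B) B) : EllTwo →L[ℂ] EllTwo :=
  (((scale g B)⁻¹ : ℝ) : ℂ) • hamiltonian g ω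

/-- The law of an i.i.d. family `(ω_j)_{j ∈ ℤ}` with single-site distribution `μ`. -/
def law {B : ℝ} (μ : Measure (Set.Icc (-B) B)) : Measure (ℤ → Set.Icc (-B) B) :=
  Measure.infinitePi fun _ : ℤ => μ

/-- `u_r(T) = ∑ c_n r^n T^n`, where `u(z) = ∑ c_n z^n` near `0`. -/
def dilatedCalculus (u : ℂ → ℂ) (T : EllTwo →L[ℂ] EllTwo) (r : ℝ) : EllTwo →L[ℂ] EllTwo :=
  ∑' n : ℕ, (iteratedDeriv n u 0 / (n.factorial : ℂ) * (r : ℂ) ^ n) • T ^ n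

open Classical in
/-- The functional calculus of contractions: `u(T)` is the strong limit of `u_r(T)` as
`r → 1⁻` (and `0` by convention if there is no such limit). -/
def calculus (u : ℂ → ℂ) (T : EllTwo →L[ℂ] EllTwo) : EllTwo →L[ℂ] EllTwo :=
  if h : ∃ A : EllTwo →L[ℂ] EllTwo,
      ∀ v, Tendsto (fun r : ℝ => dilatedCalculus u T r v) (𝓝[<] 1) (𝓝 (A v))
  then h.choose else 0

/-- The density of states functional `L^{(g)}(f) = 𝔼 ⟨φ_0, f(T_ω(g)) φ_0⟩`. The family is ergodic
under the translations by all of `ℤ`, so the primitive cell is the single site `0`. -/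
def dosFunctional (g : ℝ) {B : ℝ} (μ : Measure (Set.Icc (-B) B)) (f : ℂ → ℂ) : ℂ :=
  ∫ ω, inner ℂ (basisVec 0) (calculus f (rescaled g ω) (basisVec 0)) ∂(law μ)

/-- For `r ∈ (0, 1)`: `ψ` is holomorphic on the disc `|z| < 1 / r`, and its conjugate represents
`L^{(g)}` on the unit circle: `L^{(g)}(f) = ∫ f(e^{it}) conj ψ(e^{it}) dt / 2π` for every `f` in the
disc algebra. -/
structure IsSymbol (g : ℝ) {B : ℝ} (μ : Measure (Set.Icc (-B) B)) (r : ℝ) (ψ : ℂ → ℂ) : Prop where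
  pos : 0 < r
  lt_one : r < 1
  holo : DifferentiableOn ℂ ψ (Metric.ball 0 r⁻¹)
  repr : ∀ f : ℂ → ℂ, DiffContOnCl ℂ f (Metric.ball 0 1) →
    dosFunctional g μ f = Real.circleAverage (fun z => f z * conj (ψ z)) 0 1

/-- The continuous functional calculus `f(A)` of a bounded self-adjoint operator `A`. -/
def selfAdjointCalculus {H : Type*} [NormedAddCommGroup H] [InnerProductSpace ℂ H]
    [CompleteSpace H] (f : ℝ → ℝ) (A : H →L[ℂ] H) : H →L[ℂ] H := cfc f A

/-- `k` is the density of states measure of the self-adjoint Anderson model `H_ω(0)`: the Radon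
measure on `ℝ` with `∫ f dk = 𝔼 ⟨φ_0, f(H_ω(0)) φ_0⟩` for all compactly supported continuous
functions `f`. -/
structure IsDensityOfStates {B : ℝ} (μ : Measure (Set.Icc (-B) B)) (k : Measure ℝ) : Prop where
  locallyFinite : IsLocallyFiniteMeasure k
  repr : ∀ f : ℝ → ℝ, Continuous f → HasCompactSupport f →
    ((∫ x, f x ∂k : ℝ) : ℂ) =
      ∫ ω, inner ℂ (basisVec 0) (selfAdjointCalculus f (hamiltonian 0 ω) (basisVec 0)) ∂(law μ)

/-- The complex plane without the two real rays `(-∞, -R]` and `[R, ∞)`. -/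
def slitPlane (R : ℝ) : Set ℂ := {z | ¬ (z.im = 0 ∧ R ≤ |z.re|)}

end NSAnderson

end

open MeasureTheory Filter Topology
open scoped ComplexConjugate

noncomputable section

namespace NSAnderson

section VonNeumann

variable {H : Type*} [NormedAddCommGroup H] [InnerProductSpace ℂ H]

theorem memlp_two_iff {H : Type*} [NormedAddCommGroup H] {u : ℤ → H} :
    Memℓp (E := fun _ : ℤ => H) u 2 ↔ Summable fun k => ‖u k‖ ^ 2 := by
  rw [memℓp_gen_iff (by norm_num)]; simp

variable (H) in
/-- The translation `(translate m u)(k) = u(k - m)` on `ℓ²(ℤ; H)`. -/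
def translate (m : ℤ) : lp (fun _ : ℤ => H) 2 →L[ℂ] lp (fun _ : ℤ => H) 2 :=
  LinearMap.mkContinuous
    { toFun := fun u => ⟨fun k => u (k - m), memlp_two_iff.2
        ((Equiv.subRight m).summable_iff.2 (memlp_two_iff.1 (lp.memℓp u)))⟩
      map_add' := fun _ _ => rfl
      map_smul' := fun _ _ => rfl } 1
    (fun u => by
      rw [one_mul]
      refine (Real.rpow_le_rpow_iff (norm_nonneg _) (norm_nonneg _) two_pos).1 ?_
      have h : ∀ v : lp (fun _ : ℤ => H) 2, ‖v‖ ^ (2 : ℝ) = ∑' k, ‖v k‖ ^ (2 : ℝ) := fun v => by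
        simpa using lp.norm_rpow_eq_tsum (E := fun _ : ℤ => H) (p := 2) (by norm_num) v
      rw [h, h]
      exact ((Equiv.subRight m).tsum_eq fun k => ‖u k‖ ^ (2 : ℝ)).le)

theorem translate_apply (m : ℤ) (u : lp (fun _ : ℤ => H) 2) (k : ℤ) :
    translate H m u k = u (k - m) := rfl

theorem translate_mul (m n : ℤ) : translate H m * translate H n = translate H (m + n) := by
  ext u k
  simp only [mul_apply_eq_comp, translate_apply, sub_sub]

theorem translate_zero : translate H 0 = 1 := by
  ext u k
  simp [translate_apply]

theorem translate_pow (m : ℤ) (n : ℕ) : translate H m ^ n = translate H (n * m) := by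
  induction n with
  | zero => simp [translate_zero]
  | succ n ih => rw [pow_succ, ih, translate_mul]; congr 1; push_cast; ring

variable [CompleteSpace H]

theorem star_translate (m : ℤ) : star (translate H m) = translate H (-m) := by
  rw [ContinuousLinearMap.star_eq_adjoint, eq_comm, ContinuousLinearMap.eq_adjoint_iff]
  intro u v
  rw [lp.inner_eq_tsum, lp.inner_eq_tsum, ← (Equiv.subRight m).tsum_eq]
  simp [translate_apply]

theorem translate_mem_unitary (m : ℤ) :
    translate H m ∈ unitary (lp (fun _ : ℤ => H) 2 →L[ℂ] lp (fun _ : ℤ => H) 2) := by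
  rw [Unitary.mem_iff, star_translate, translate_mul, translate_mul]
  simp [translate_zero]

/-- A bound for polynomials on the unit circle is a bound for polynomials of a unitary. -/
theorem norm_sum_smul_pow_le_of_unitary {A : Type*} [CStarAlgebra A] {U : A} (hU : U ∈ unitary A)
    (a : ℕ → ℂ) (m : ℕ) {C : ℝ}
    (hC : ∀ z : ℂ, ‖z‖ = 1 → ‖∑ n ∈ Finset.range m, a n * z ^ n‖ ≤ C) :
    ‖∑ n ∈ Finset.range m, a n • U ^ n‖ ≤ C := by
  have h0 : 0 ≤ C := (norm_nonneg _).trans (hC 1 (by simp))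
  have hn : IsStarNormal U := ⟨by
    rw [commute_iff_eq, (Unitary.mem_iff.1 hU).1, (Unitary.mem_iff.1 hU).2]⟩
  have h := cfc_polynomial (∑ n ∈ Finset.range m, Polynomial.monomial n (a n)) U
  have e : Polynomial.aeval U (∑ n ∈ Finset.range m, Polynomial.monomial n (a n)) =
      ∑ n ∈ Finset.range m, a n • U ^ n := by
    simp [map_sum, Polynomial.aeval_monomial, Algebra.smul_def]
  rw [← e, ← h]
  refine norm_cfc_le h0 fun z hz => ?_
  have hz1 : ‖z‖ = 1 := by
    simpa using spectrum.subset_circle_of_unitary hU hz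
  simpa [Polynomial.eval_finsetSum] using hC z hz1

/-- The defect operator of a contraction. -/
theorem exists_defect {T : H →L[ℂ] H} (hT : ‖T‖ ≤ 1) :
    ∃ D : H →L[ℂ] H, ∀ x y, inner ℂ (D x) (D y) = inner ℂ x y - inner ℂ (T x) (T y) := by
  have hp : (0 : H →L[ℂ] H) ≤ 1 - star T * T := by
    rw [ContinuousLinearMap.nonneg_iff_isPositive]
    refine ⟨?_, fun x => ?_⟩
    · intro x y
      simp [inner_sub_left, inner_sub_right, ContinuousLinearMap.star_eq_adjoint,
        ContinuousLinearMap.adjoint_inner_left, ContinuousLinearMap.adjoint_inner_right]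
    · have h1 : ‖T x‖ ≤ ‖x‖ := by simpa using T.le_of_opNorm_le hT x
      have h2 : ‖T x‖ ^ 2 ≤ ‖x‖ ^ 2 := by gcongr
      have h3 := inner_self_eq_norm_sq (𝕜 := ℂ) x
      have h4 := inner_self_eq_norm_sq (𝕜 := ℂ) (T x)
      simp only [ContinuousLinearMap.reApplyInnerSelf, sub_apply,
        one_apply_eq_self, mul_apply_eq_comp, inner_sub_left,
        ContinuousLinearMap.star_eq_adjoint, ContinuousLinearMap.adjoint_inner_left, map_sub]
      linarith
  refine ⟨CFC.sqrt (1 - star T * T), fun x y => ?_⟩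
  have hs : ContinuousLinearMap.adjoint (CFC.sqrt (1 - star T * T)) = CFC.sqrt (1 - star T * T) :=
    (IsSelfAdjoint.of_nonneg (CFC.sqrt_nonneg (1 - star T * T))).star_eq
  have hm := CFC.sqrt_mul_sqrt_self (1 - star T * T) hp
  rw [← ContinuousLinearMap.adjoint_inner_right, hs, ← mul_apply_eq_comp, hm]
  simp [inner_sub_right, ContinuousLinearMap.star_eq_adjoint,
        ContinuousLinearMap.adjoint_inner_right]

end VonNeumann

section Contraction

variable {H : Type*} [NormedAddCommGroup H] [InnerProductSpace ℂ H]

theorem norm_pow_apply_le {T : H →L[ℂ] H} {q : ℝ} (hT : ‖T‖ ≤ q) (n : ℕ) (x : H) :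
    ‖(T ^ n) x‖ ≤ q ^ n * ‖x‖ := by
  have hq : 0 ≤ q := (norm_nonneg _).trans hT
  induction n with
  | zero => simp
  | succ n ih =>
    rw [pow_succ', mul_apply_eq_comp]
    calc ‖T ((T ^ n) x)‖ ≤ q * ‖(T ^ n) x‖ := T.le_of_opNorm_le hT _
      _ ≤ q * (q ^ n * ‖x‖) := by gcongr
      _ = q ^ (n + 1) * ‖x‖ := by ring

theorem norm_pow_le_one {T : H →L[ℂ] H} (hT : ‖T‖ ≤ 1) (n : ℕ) : ‖T ^ n‖ ≤ 1 :=
  ContinuousLinearMap.opNorm_le_bound _ zero_le_one fun x => by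
    simpa using norm_pow_apply_le hT n x

/-- Telescoping of the defect form of a strict contraction. -/
theorem hasSum_inner_defect {T D : H →L[ℂ] H} (hT : ‖T‖ < 1)
    (hD : ∀ x y, inner ℂ (D x) (D y) = inner ℂ x y - inner ℂ (T x) (T y)) (x y : H) :
    HasSum (fun n : ℕ => inner ℂ (D ((T ^ n) x)) (D ((T ^ n) y))) (inner ℂ x y) := by
  have hs : Summable fun n : ℕ => inner ℂ ((T ^ n) x) ((T ^ n) y) := by
    refine Summable.of_norm_bounded (g := fun n => (‖T‖ * ‖T‖) ^ n * (‖x‖ * ‖y‖)) ?_ fun n => ?_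
    · exact (summable_geometric_of_lt_one (by positivity)
        (mul_lt_one_of_nonneg_of_lt_one_left (norm_nonneg _) hT hT.le)).mul_right _
    · calc _ ≤ ‖(T ^ n) x‖ * ‖(T ^ n) y‖ := norm_inner_le_norm _ _
        _ ≤ (‖T‖ ^ n * ‖x‖) * (‖T‖ ^ n * ‖y‖) := by
          gcongr <;> exact norm_pow_apply_le le_rfl _ _
        _ = _ := by rw [mul_pow]; ring
  have h1 := hs.hasSum
  have h2 := (hasSum_nat_add_iff' 1).2 h1
  have h3 := h1.sub h2
  simp only [Finset.sum_range_one, pow_zero, sub_sub_cancel, one_apply_eq_self] at h3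
  refine h3.congr_fun fun n => ?_
  rw [hD, pow_succ', mul_apply_eq_comp, mul_apply_eq_comp]

/-- The isometric embedding of `H` into the space of the bilateral shift. -/
theorem exists_dilation [CompleteSpace H] {T : H →L[ℂ] H} (hT : ‖T‖ < 1) :
    ∃ W : H → lp (fun _ : ℤ => H) 2, ∀ (n : ℕ) (x y : H),
      inner ℂ (W x) ((translate H (-1) ^ n) (W y)) = inner ℂ x ((T ^ n) y) := by
  obtain ⟨D, hD⟩ := exists_defect hT.le
  let w : H → ℤ → H := fun x k => if 0 ≤ k then D ((T ^ k.toNat) x) else 0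
  have hw : ∀ x, Memℓp (E := fun _ : ℤ => H) (w x) 2 := fun x => by
    rw [memlp_two_iff, ← Function.Injective.summable_iff Nat.cast_injective]
    · have h := (hasSum_inner_defect hT hD x x).summable
      have h' := h.norm
      refine h'.congr fun n => ?_
      simp [w, inner_self_eq_norm_sq_to_K]
    · intro k hk
      have : ¬ 0 ≤ k := fun h => hk ⟨k.toNat, by simpa using h⟩
      simp [w, this]
  refine ⟨fun x => ⟨w x, hw x⟩, fun n x y => ?_⟩
  rw [lp.inner_eq_tsum, translate_pow, ← (hasSum_inner_defect hT hD x ((T ^ n) y)).tsum_eq,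
    ← Function.Injective.tsum_eq (g := ((↑) : ℕ → ℤ)) Nat.cast_injective]
  · refine tsum_congr fun k => ?_
    rw [translate_apply]
    have e : (0 : ℤ) ≤ (k : ℤ) - (n : ℤ) * (-1) := by omega
    have e' : ((k : ℤ) - (n : ℤ) * (-1)).toNat = k + n := by omega
    simp only [w, e, e', if_true, Int.toNat_natCast, Nat.cast_nonneg, pow_add, mul_apply_eq_comp]
  · intro k hk
    by_contra h
    have : ¬ 0 ≤ k := fun h' => h ⟨k.toNat, by simpa using h'⟩
    simp [w, this] at hk

/-- Von Neumann's inequality for polynomials of a contraction. -/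
theorem norm_sum_smul_pow_le [CompleteSpace H] {T : H →L[ℂ] H} (hT : ‖T‖ ≤ 1)
    (a : ℕ → ℂ) (m : ℕ) {C : ℝ}
    (hC : ∀ z : ℂ, ‖z‖ = 1 → ‖∑ n ∈ Finset.range m, a n * z ^ n‖ ≤ C) :
    ‖∑ n ∈ Finset.range m, a n • T ^ n‖ ≤ C := by
  have h0 : 0 ≤ C := (norm_nonneg _).trans (hC 1 (by simp))
  have strict : ∀ S : H →L[ℂ] H, ‖S‖ < 1 → ‖∑ n ∈ Finset.range m, a n • S ^ n‖ ≤ C := by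
    intro S hS
    obtain ⟨W, hW⟩ := exists_dilation hS
    have hn : ∀ x, ‖W x‖ = ‖x‖ := fun x => by
      have h := hW 0 x x
      simp only [pow_zero, one_apply_eq_self, inner_self_eq_norm_sq_to_K] at h
      have h' : ‖W x‖ ^ 2 = ‖x‖ ^ 2 := by exact_mod_cast h
      exact (sq_eq_sq₀ (norm_nonneg _) (norm_nonneg _)).1 h'
    have hU := norm_sum_smul_pow_le_of_unitary (translate_mem_unitary (H := H) (-1)) a m hC
    refine ContinuousLinearMap.opNorm_le_bound _ h0 fun y => ?_
    set p := ∑ n ∈ Finset.range m, a n • S ^ n with hp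
    set P := ∑ n ∈ Finset.range m, a n • translate H (-1) ^ n with hP
    have hPp : ∀ v, inner ℂ (W v) (P (W y)) = inner ℂ v (p y) := fun v => by
      simp only [hP, hp, sum_apply, smul_apply, inner_sum, inner_smul_right, hW]
    have h1 : ‖p y‖ * ‖p y‖ ≤ ‖p y‖ * (C * ‖y‖) := by
      calc ‖p y‖ * ‖p y‖ = ‖inner ℂ (p y) (p y)‖ := by
            rw [inner_self_eq_norm_sq_to_K]; simp [sq]
        _ ≤ ‖W (p y)‖ * ‖P (W y)‖ := by rw [← hPp]; exact norm_inner_le_norm _ _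
        _ ≤ ‖W (p y)‖ * (C * ‖W y‖) := by gcongr; exact P.le_of_opNorm_le hU _
        _ = _ := by rw [hn, hn]
    rcases (norm_nonneg (p y)).eq_or_lt with h | h
    · rw [← h]; positivity
    · exact le_of_mul_le_mul_left h1 h
  have hc : Tendsto (fun ρ : ℝ => ‖∑ n ∈ Finset.range m, a n • ((ρ : ℂ) • T) ^ n‖) (𝓝[<] 1)
      (𝓝 ‖∑ n ∈ Finset.range m, a n • (((1 : ℝ) : ℂ) • T) ^ n‖) := by
    refine Tendsto.mono_left (Continuous.tendsto ?_ 1) nhdsWithin_le_nhds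
    fun_prop
  rw [Complex.ofReal_one, one_smul] at hc
  refine le_of_tendsto hc ?_
  filter_upwards [Ioo_mem_nhdsLT (show (0 : ℝ) < 1 by norm_num)] with ρ hρ
  refine strict _ ?_
  rw [norm_smul, Complex.norm_real, Real.norm_of_nonneg hρ.1.le]
  nlinarith [hρ.1, hρ.2, norm_nonneg T]

end Contraction

/-- The Taylor coefficients at `0`. -/
def taylorCoeff (f : ℂ → ℂ) (n : ℕ) : ℂ := iteratedDeriv n f 0 / (n.factorial : ℂ)

theorem hasSum_taylorCoeff {f : ℂ → ℂ} {R : ℝ} (hf : DifferentiableOn ℂ f (Metric.ball 0 R))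
    {z : ℂ} (hz : z ∈ Metric.ball 0 R) : HasSum (fun n => taylorCoeff f n * z ^ n) (f z) := by
  refine (Complex.hasSum_taylorSeries_on_ball hf hz).congr_fun fun n => ?_
  simp only [taylorCoeff, sub_zero, smul_eq_mul]
  ring

theorem taylorCoeff_of_hasFPowerSeriesOnBall {f : ℂ → ℂ} {p : FormalMultilinearSeries ℂ ℂ ℂ}
    {r : ENNReal} (h : HasFPowerSeriesOnBall f p 0 r) (n : ℕ) :
    taylorCoeff f n = p n fun _ => 1 := by
  have h1 := h.factorial_smul (1 : ℂ) n
  rw [taylorCoeff, iteratedDeriv_eq_iteratedFDeriv, ← h1, nsmul_eq_mul]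
  exact mul_div_cancel_left₀ _ (Nat.cast_ne_zero.2 n.factorial_ne_zero)

theorem circleAverage_mul_conj_pow {f : ℂ → ℂ} (hf : DiffContOnCl ℂ f (Metric.ball 0 1)) (n : ℕ) :
    Real.circleAverage (fun z => f z * conj z ^ n) 0 1 = taylorCoeff f n := by
  have h := DiffContOnCl.hasFPowerSeriesOnBall (R := 1) (by simpa using hf) one_pos
  rw [taylorCoeff_of_hasFPowerSeriesOnBall h, cauchyPowerSeries_apply,
    Real.circleAverage_eq_circleIntegral one_ne_zero]
  congr 1
  refine circleIntegral.integral_congr zero_le_one fun z hz => ?_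
  have hz1 : ‖z‖ = 1 := by simpa using hz
  simp only [sub_zero, smul_eq_mul, Complex.inv_eq_conj hz1, one_div]
  ring

theorem circleAverage_conj (f : ℂ → ℂ) :
    Real.circleAverage (fun z => conj (f z)) 0 1 = conj (Real.circleAverage f 0 1) := by
  simp only [Real.circleAverage, intervalIntegral.integral_of_le Real.two_pi_pos.le, integral_conj]
  simp [map_ofNat]

theorem circleAverage_pow_mul_conj {f : ℂ → ℂ} (hf : DiffContOnCl ℂ f (Metric.ball 0 1)) (n : ℕ) :
    Real.circleAverage (fun z => z ^ n * conj (f z)) 0 1 = conj (taylorCoeff f n) := by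
  rw [← circleAverage_mul_conj_pow hf n, ← circleAverage_conj]
  simp [mul_comm]

theorem taylorCoeff_of_hasSum {f : ℂ → ℂ} {a : ℕ → ℂ} {R : ℝ} (hR : 0 < R)
    (h : ∀ z ∈ Metric.ball (0 : ℂ) R, HasSum (fun n => a n * z ^ n) (f z)) (n : ℕ) :
    taylorCoeff f n = a n := by
  have h1 : HasFPowerSeriesAt f (FormalMultilinearSeries.ofScalars ℂ a) 0 := by
    rw [hasFPowerSeriesAt_iff]
    filter_upwards [Metric.ball_mem_nhds (0 : ℂ) hR] with z hz
    simpa [FormalMultilinearSeries.coeff_ofScalars, mul_comm] using h z hz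
  obtain ⟨r, hr⟩ := h1
  rw [taylorCoeff_of_hasFPowerSeriesOnBall hr]
  simp

theorem differentiableOn_of_hasSum {f : ℂ → ℂ} {a : ℕ → ℂ} {R : ℝ}
    (h : ∀ z ∈ Metric.ball (0 : ℂ) R, HasSum (fun n => a n * z ^ n) (f z)) :
    DifferentiableOn ℂ f (Metric.ball 0 R) := by
  rcases le_or_gt R 0 with hR | hR
  · rw [Metric.ball_eq_empty.2 hR]; exact differentiableOn_empty
  have hb : HasFPowerSeriesOnBall f (FormalMultilinearSeries.ofScalars ℂ a) 0
      (ENNReal.ofReal R) := by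
    refine ⟨?_, by simpa using hR, fun {y} hy => ?_⟩
    · refine ENNReal.le_of_forall_nnreal_lt fun q hq => ?_
      refine FormalMultilinearSeries.le_radius_of_summable_norm _ ?_
      have hq' : ((q : ℝ) : ℂ) ∈ Metric.ball (0 : ℂ) R := by
        rw [mem_ball_zero_iff, Complex.norm_real, Real.norm_of_nonneg q.coe_nonneg]
        simpa using (ENNReal.lt_ofReal_iff_toReal_lt (by simp)).1 hq
      refine (h _ hq').summable.norm.congr fun n => ?_
      simp
    · have hy' : y ∈ Metric.ball (0 : ℂ) R := by
        rwa [Metric.eball_ofReal] at hy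
      simpa [FormalMultilinearSeries.ofScalars_apply_eq, mul_comm] using h y hy'
  have := hb.differentiableOn
  rwa [Metric.eball_ofReal] at this

theorem summable_smul_pow {H : Type*} [NormedAddCommGroup H] [InnerProductSpace ℂ H]
    [CompleteSpace H] {T : H →L[ℂ] H} (hT : ‖T‖ ≤ 1)
    {a : ℕ → ℂ} (ha : Summable fun n => ‖a n‖) : Summable fun n => a n • T ^ n :=
  Summable.of_norm_bounded ha fun n => by
    rw [norm_smul]
    exact mul_le_of_le_one_right (norm_nonneg _) (norm_pow_le_one hT n)

/-- Von Neumann's inequality for absolutely convergent power series of a contraction. -/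
theorem norm_tsum_smul_pow_le {H : Type*} [NormedAddCommGroup H] [InnerProductSpace ℂ H]
    [CompleteSpace H] {T : H →L[ℂ] H} (hT : ‖T‖ ≤ 1)
    {a : ℕ → ℂ} (ha : Summable fun n => ‖a n‖) {C : ℝ}
    (hC : ∀ z : ℂ, ‖z‖ = 1 → ‖∑' n, a n * z ^ n‖ ≤ C) : ‖∑' n, a n • T ^ n‖ ≤ C := by
  have h1 : Tendsto (fun m => ‖∑ n ∈ Finset.range m, a n • T ^ n‖) atTop
      (𝓝 ‖∑' n, a n • T ^ n‖) :=
    (summable_smul_pow hT ha).hasSum.tendsto_sum_nat.norm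
  have h2 : Tendsto (fun m => C + ∑' n, ‖a (n + m)‖) atTop (𝓝 (C + 0)) :=
    tendsto_const_nhds.add (tendsto_sum_nat_add fun n => ‖a n‖)
  rw [add_zero] at h2
  refine le_of_tendsto_of_tendsto' h1 h2 fun m => norm_sum_smul_pow_le hT a m fun z hz => ?_
  have hs : Summable fun n => a n * z ^ n :=
    Summable.of_norm (by simpa [hz] using ha)
  have hm := hs.sum_add_tsum_nat_add m
  rw [← eq_sub_iff_add_eq] at hm
  rw [hm]
  refine (norm_sub_le _ _).trans (add_le_add (hC z hz) ?_)
  have ht : Summable fun n => ‖a (n + m) * z ^ (n + m)‖ := by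
    simpa [hz] using (summable_nat_add_iff m).2 ha
  refine (norm_tsum_le_tsum_norm ht).trans_eq ?_
  simp [hz]

theorem summable_norm_taylorCoeff {f : ℂ → ℂ} (hf : DifferentiableOn ℂ f (Metric.ball 0 1)) {r : ℝ}
    (h0 : 0 ≤ r) (h1 : r < 1) : Summable fun n => ‖taylorCoeff f n‖ * r ^ n := by
  have hz : (r : ℂ) ∈ Metric.ball (0 : ℂ) 1 := by
    rwa [mem_ball_zero_iff, Complex.norm_real, Real.norm_of_nonneg h0]
  refine (hasSum_taylorCoeff hf hz).summable.norm.congr fun n => ?_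
  rw [norm_mul, norm_pow, Complex.norm_real, Real.norm_of_nonneg h0]

theorem summable_norm_taylorCoeff_mul {f : ℂ → ℂ} (hf : DifferentiableOn ℂ f (Metric.ball 0 1))
    {r : ℝ} (h0 : 0 ≤ r) (h1 : r < 1) : Summable fun n => ‖taylorCoeff f n * (r : ℂ) ^ n‖ := by
  refine (summable_norm_taylorCoeff hf h0 h1).congr fun n => ?_
  rw [norm_mul, norm_pow, Complex.norm_real, Real.norm_of_nonneg h0]

theorem norm_dilatedCalculus_sub_le {f : ℂ → ℂ} (hf : DifferentiableOn ℂ f (Metric.ball 0 1))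
    {T : EllTwo →L[ℂ] EllTwo} (hT : ‖T‖ ≤ 1) {r s C : ℝ} (hr : 0 ≤ r) (hr1 : r < 1) (hs : 0 ≤ s)
    (hs1 : s < 1) (hC : ∀ z : ℂ, ‖z‖ = 1 → ‖f (r * z) - f (s * z)‖ ≤ C) :
    ‖dilatedCalculus f T r - dilatedCalculus f T s‖ ≤ C := by
  have ar := summable_norm_taylorCoeff_mul hf hr hr1
  have as := summable_norm_taylorCoeff_mul hf hs hs1
  have ha : Summable fun n => ‖taylorCoeff f n * (r : ℂ) ^ n - taylorCoeff f n * (s : ℂ) ^ n‖ :=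
    Summable.of_nonneg_of_le (fun _ => norm_nonneg _) (fun _ => norm_sub_le _ _) (ar.add as)
  have e : dilatedCalculus f T r - dilatedCalculus f T s =
      ∑' n, (taylorCoeff f n * (r : ℂ) ^ n - taylorCoeff f n * (s : ℂ) ^ n) • T ^ n := by
    simp only [dilatedCalculus, ← taylorCoeff.eq_1, sub_smul]
    exact ((summable_smul_pow hT ar).tsum_sub (summable_smul_pow hT as)).symm
  rw [e]
  refine norm_tsum_smul_pow_le hT ha fun z hz => ?_
  have key : ∀ t : ℝ, 0 ≤ t → t < 1 →
      HasSum (fun n => taylorCoeff f n * (t : ℂ) ^ n * z ^ n) (f (t * z)) := fun t h0 h1 => by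
    have hz' : (t : ℂ) * z ∈ Metric.ball (0 : ℂ) 1 := by
      rwa [mem_ball_zero_iff, norm_mul, hz, mul_one, Complex.norm_real, Real.norm_of_nonneg h0]
    simpa [mul_pow, mul_assoc] using hasSum_taylorCoeff hf hz'
  have := (key r hr hr1).sub (key s hs hs1)
  simp only [← sub_mul] at this
  rw [this.tsum_eq]
  exact hC z hz

/-- The functional calculus of a contraction exists on the disc algebra, with convergence in
norm. -/
theorem exists_tendsto_dilatedCalculus {f : ℂ → ℂ} (hf : DiffContOnCl ℂ f (Metric.ball 0 1))
    {T : EllTwo →L[ℂ] EllTwo} (hT : ‖T‖ ≤ 1) :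
    ∃ A, Tendsto (dilatedCalculus f T) (𝓝[<] 1) (𝓝 A) := by
  rw [← cauchy_map_iff_exists_tendsto, Metric.cauchy_iff]
  refine ⟨inferInstance, fun ε hε => ?_⟩
  have huc := (isCompact_closedBall (0 : ℂ) 1).uniformContinuousOn_of_continuous
    (closure_ball (0 : ℂ) one_ne_zero ▸ hf.continuousOn)
  obtain ⟨δ, hδ, h⟩ := Metric.uniformContinuousOn_iff.1 huc (ε / 2) (half_pos hε)
  refine ⟨_, image_mem_map (Ioo_mem_nhdsLT (show max 0 (1 - δ) < 1 by simp [hδ])), ?_⟩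
  rintro _ ⟨r, hr, rfl⟩ _ ⟨s, hs, rfl⟩
  have hr0 := (le_max_left _ _).trans_lt hr.1
  have hs0 := (le_max_left _ _).trans_lt hs.1
  have hr2 := (le_max_right _ _).trans_lt hr.1
  have hs2 := (le_max_right _ _).trans_lt hs.1
  rw [dist_eq_norm]
  refine (norm_dilatedCalculus_sub_le hf.1 hT hr0.le hr.2 hs0.le hs.2 fun z hz => ?_).trans_lt
    (half_lt_self hε)
  have mem : ∀ t : ℝ, 0 < t → t < 1 → (t : ℂ) * z ∈ Metric.closedBall (0 : ℂ) 1 :=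
    fun t h0 h1 => by
      rw [mem_closedBall_zero_iff, norm_mul, hz, mul_one, Complex.norm_real,
        Real.norm_of_nonneg h0.le]
      exact h1.le
  rw [← dist_eq_norm]
  refine (h _ (mem r hr0 hr.2) _ (mem s hs0 hs.2) ?_).le
  rw [dist_eq_norm, ← sub_mul, norm_mul, hz, mul_one, ← Complex.ofReal_sub, Complex.norm_real,
    Real.norm_eq_abs, abs_lt]
  constructor <;> linarith [hr.2, hs.2]

theorem tendsto_dilatedCalculus {f : ℂ → ℂ} (hf : DiffContOnCl ℂ f (Metric.ball 0 1))
    {T : EllTwo →L[ℂ] EllTwo} (hT : ‖T‖ ≤ 1) (v : EllTwo) :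
    Tendsto (fun r : ℝ => dilatedCalculus f T r v) (𝓝[<] 1) (𝓝 (calculus f T v)) := by
  have h : ∃ A : EllTwo →L[ℂ] EllTwo,
      ∀ v, Tendsto (fun r : ℝ => dilatedCalculus f T r v) (𝓝[<] 1) (𝓝 (A v)) := by
    obtain ⟨A, hA⟩ := exists_tendsto_dilatedCalculus hf hT
    exact ⟨A, fun v => ((ContinuousLinearMap.apply ℂ EllTwo v).continuous.tendsto A).comp hA⟩
  rw [calculus, dif_pos h]
  exact h.choose_spec v

/-- Matrix elements of the functional calculus, when those of the powers decay geometrically. -/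
theorem hasSum_inner_calculus {f : ℂ → ℂ} (hf : DiffContOnCl ℂ f (Metric.ball 0 1))
    {T : EllTwo →L[ℂ] EllTwo} (hT : ‖T‖ ≤ 1) (u v : EllTwo) {q : ℝ} (hq0 : 0 ≤ q) (hq : q < 1)
    (hm : ∀ n : ℕ, ‖inner ℂ u ((T ^ n) v)‖ ≤ q ^ n) :
    HasSum (fun n => taylorCoeff f n * inner ℂ u ((T ^ n) v)) (inner ℂ u (calculus f T v)) := by
  have hb := summable_norm_taylorCoeff hf.1 hq0 hq
  have hle : ∀ n, ‖taylorCoeff f n * inner ℂ u ((T ^ n) v)‖ ≤ ‖taylorCoeff f n‖ * q ^ n :=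
    fun n => by rw [norm_mul]; gcongr; exact hm n
  have h1 : Tendsto (fun r : ℝ => inner ℂ u (dilatedCalculus f T r v)) (𝓝[<] 1)
      (𝓝 (inner ℂ u (calculus f T v))) :=
    tendsto_const_nhds.inner (tendsto_dilatedCalculus hf hT v)
  have hev : ∀ᶠ r : ℝ in 𝓝[<] 1, r ∈ Set.Ioo (0 : ℝ) 1 :=
    Ioo_mem_nhdsLT (show (0 : ℝ) < 1 by norm_num)
  have h2 : Tendsto (fun r : ℝ => ∑' n, taylorCoeff f n * (r : ℂ) ^ n * inner ℂ u ((T ^ n) v))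
      (𝓝[<] 1) (𝓝 (∑' n, taylorCoeff f n * inner ℂ u ((T ^ n) v))) := by
    refine tendsto_tsum_of_dominated_convergence hb (fun n => ?_) ?_
    · have : Continuous fun r : ℝ => taylorCoeff f n * (r : ℂ) ^ n * inner ℂ u ((T ^ n) v) := by
        fun_prop
      simpa using (this.tendsto 1).mono_left nhdsWithin_le_nhds
    · filter_upwards [hev] with r hr n
      rw [mul_right_comm, norm_mul, norm_pow, Complex.norm_real, Real.norm_of_nonneg hr.1.le]
      exact (mul_le_of_le_one_right (norm_nonneg _) (pow_le_one₀ hr.1.le hr.2.le)).trans (hle n)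
  have h3 : (fun r : ℝ => inner ℂ u (dilatedCalculus f T r v)) =ᶠ[𝓝[<] 1]
      fun r : ℝ => ∑' n, taylorCoeff f n * (r : ℂ) ^ n * inner ℂ u ((T ^ n) v) := by
    filter_upwards [hev] with r hr
    have hs := summable_smul_pow hT (summable_norm_taylorCoeff_mul hf.1 hr.1.le hr.2)
    have := (hs.hasSum.mapL (ContinuousLinearMap.apply ℂ EllTwo v)).mapL (innerSL ℂ u)
    simpa [inner_smul_right, dilatedCalculus, taylorCoeff] using this.tsum_eq.symm
  rw [tendsto_nhds_unique h1 (h2.congr' h3.symm)]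
  exact (Summable.of_norm_bounded hb hle).hasSum

theorem hamiltonian_apply (g : ℝ) {B : ℝ} (ω : ℤ → Set.Icc (-B) B) (u : EllTwo) (k : ℤ) :
    hamiltonian g ω u k = (Real.exp (-g) : ℂ) * u (k + 1) + (Real.exp g : ℂ) * u (k - 1) +
      ((ω k : ℝ) : ℂ) * u k := by
  rw [hamiltonian, add_apply, add_apply, smul_apply, smul_apply, lp.coeFn_add, Pi.add_apply,
    lp.coeFn_add, Pi.add_apply, lp.coeFn_smul, lp.coeFn_smul, Pi.smul_apply, Pi.smul_apply,
    shift_apply, shift_apply, potential_apply, sub_neg_eq_add, smul_eq_mul, smul_eq_mul]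

theorem norm_hamiltonian_le (g : ℝ) {B : ℝ} (hB : 0 ≤ B) (ω : ℤ → Set.Icc (-B) B) :
    ‖hamiltonian g ω‖ ≤ scale g B := by
  have h1 : ∀ m, ‖shift m‖ ≤ 1 := fun m => LinearMap.mkContinuous_norm_le _ zero_le_one _
  have h2 : ‖potential ω‖ ≤ B :=
    (LinearMap.mkContinuous_norm_le _ (abs_nonneg _) _).trans_eq (abs_of_nonneg hB)
  have h3 : ∀ (x : ℝ) m, ‖((Real.exp x : ℝ) : ℂ) • shift m‖ ≤ Real.exp x := fun x m => by
    rw [norm_smul, Complex.norm_real, Real.norm_of_nonneg (Real.exp_pos x).le]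
    exact mul_le_of_le_one_right (Real.exp_pos x).le (h1 m)
  calc ‖hamiltonian g ω‖ ≤ Real.exp (-g) + Real.exp g + B :=
        (norm_add₃_le).trans (add_le_add (add_le_add (h3 _ _) (h3 _ _)) h2)
    _ = scale g B := by rw [scale]; ring

theorem scale_zero (B : ℝ) : scale 0 B = 2 + B := by
  rw [scale]; norm_num

theorem two_add_lt_scale {g : ℝ} (hg : 0 < g) (B : ℝ) : 2 + B < scale g B := by
  have h1 := Real.add_one_lt_exp hg.ne'
  have h : 2 < Real.exp g + Real.exp (-g) := by
    rw [Real.exp_neg]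
    have hp := Real.exp_pos g
    have : (Real.exp g - 1) ^ 2 > 0 := by nlinarith
    have h2 : Real.exp g + (Real.exp g)⁻¹ - 2 = (Real.exp g - 1) ^ 2 / Real.exp g := by
      field_simp; ring
    have h3 : 0 < (Real.exp g - 1) ^ 2 / Real.exp g := by positivity
    linarith
  rw [scale]; linarith

theorem norm_rescaled_le (g : ℝ) {B : ℝ} (hB : 0 ≤ B) (ω : ℤ → Set.Icc (-B) B) :
    ‖rescaled g ω‖ ≤ 1 := by
  have hs : 0 < scale g B := by rw [scale]; positivity
  rw [rescaled, norm_smul, Complex.norm_real, Real.norm_of_nonneg (inv_nonneg.2 hs.le)]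
  rw [inv_mul_le_iff₀ hs, mul_one]
  exact norm_hamiltonian_le g hB ω

theorem inner_basisVec (k : ℤ) (u : EllTwo) : inner ℂ (basisVec k) u = u k := by
  rw [basisVec, lp.inner_single_left]; simp

theorem norm_basisVec (k : ℤ) : ‖basisVec k‖ = 1 := by
  rw [basisVec, lp.norm_single (by norm_num)]; simp

/-- The imaginary gauge transformation. -/
theorem hamiltonian_pow_basisVec_apply (g : ℝ) {B : ℝ} (ω : ℤ → Set.Icc (-B) B) (n : ℕ) (k : ℤ) :
    (hamiltonian g ω ^ n) (basisVec 0) k =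
      (Real.exp (g * k) : ℂ) * (hamiltonian 0 ω ^ n) (basisVec 0) k := by
  induction n generalizing k with
  | zero =>
    by_cases h : k = 0
    · subst h; simp [basisVec]
    · simp [basisVec, h]
  | succ n ih =>
    rw [pow_succ', pow_succ', mul_apply_eq_comp, mul_apply_eq_comp, hamiltonian_apply,
      hamiltonian_apply, ih, ih, ih]
    have e1 : (Real.exp (-g) : ℂ) * Real.exp (g * ((k + 1 : ℤ) : ℝ)) = Real.exp (g * k) := by
      rw [← Complex.ofReal_mul, ← Real.exp_add]; congr 2; push_cast; ring
    have e2 : (Real.exp g : ℂ) * Real.exp (g * ((k - 1 : ℤ) : ℝ)) = Real.exp (g * k) := by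
      rw [← Complex.ofReal_mul, ← Real.exp_add]; congr 2; push_cast; ring
    rw [← mul_assoc, ← mul_assoc, e1, e2]
    simp only [neg_zero, Real.exp_zero, Complex.ofReal_one, one_mul]
    ring

theorem im_hamiltonian_pow_basisVec_apply (g : ℝ) {B : ℝ} (ω : ℤ → Set.Icc (-B) B) (n : ℕ)
    (k : ℤ) : ((hamiltonian g ω ^ n) (basisVec 0) k).im = 0 := by
  induction n generalizing k with
  | zero =>
    by_cases h : k = 0
    · subst h; simp [basisVec]
    · simp [basisVec, h]
  | succ n ih =>
    rw [pow_succ', mul_apply_eq_comp, hamiltonian_apply]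
    simp only [Complex.add_im, Complex.mul_im, Complex.ofReal_im, ih, mul_zero, zero_mul, add_zero]

theorem measurable_hamiltonian_pow_basisVec_apply (g B : ℝ) (n : ℕ) (k : ℤ) :
    Measurable (β := ℂ) fun ω : ℤ → Set.Icc (-B) B => (hamiltonian g ω ^ n) (basisVec 0) k := by
  induction n generalizing k with
  | zero => simp
  | succ n ih =>
    simp only [pow_succ', mul_apply_eq_comp, hamiltonian_apply]
    have h : Measurable fun ω : ℤ → Set.Icc (-B) B => ((ω k : ℝ) : ℂ) :=
      Complex.measurable_ofReal.comp (measurable_subtype_coe.comp (measurable_pi_apply k))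
    have hc : ∀ x : ℝ, Measurable fun _ : ℤ → Set.Icc (-B) B => (x : ℂ) := fun x =>
      measurable_const
    exact (((hc _).mul (ih _)).add ((hc _).mul (ih _))).add (h.mul (ih k))

/-- The moments `⟨φ_0, H_ω(0)^n φ_0⟩`. -/
def moment {B : ℝ} (n : ℕ) (ω : ℤ → Set.Icc (-B) B) : ℝ :=
  ((hamiltonian 0 ω ^ n) (basisVec 0) 0).re

theorem inner_hamiltonian_pow (g : ℝ) {B : ℝ} (ω : ℤ → Set.Icc (-B) B) (n : ℕ) :
    inner ℂ (basisVec 0) ((hamiltonian g ω ^ n) (basisVec 0)) = (moment n ω : ℂ) := by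
  rw [inner_basisVec, hamiltonian_pow_basisVec_apply]
  apply Complex.ext
  · simp [moment]
  · rw [Complex.mul_im, im_hamiltonian_pow_basisVec_apply, Complex.ofReal_im, Complex.ofReal_im]
    ring

theorem measurable_moment (B : ℝ) (n : ℕ) :
    Measurable fun ω : ℤ → Set.Icc (-B) B => moment n ω :=
  Complex.measurable_re.comp (measurable_hamiltonian_pow_basisVec_apply 0 B n 0)

theorem abs_moment_le {B : ℝ} (hB : 0 ≤ B) (n : ℕ) (ω : ℤ → Set.Icc (-B) B) :
    |moment n ω| ≤ (2 + B) ^ n := by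
  have h := norm_inner_le_norm (𝕜 := ℂ) (basisVec 0) ((hamiltonian 0 ω ^ n) (basisVec 0))
  rw [inner_hamiltonian_pow, Complex.norm_real, Real.norm_eq_abs, norm_basisVec, one_mul] at h
  refine h.trans ((norm_pow_apply_le (norm_hamiltonian_le 0 hB ω) n _).trans_eq ?_)
  rw [norm_basisVec, scale_zero, mul_one]

theorem inner_rescaled_pow (g : ℝ) {B : ℝ} (ω : ℤ → Set.Icc (-B) B) (n : ℕ) :
    inner ℂ (basisVec 0) ((rescaled g ω ^ n) (basisVec 0)) =
      ((moment n ω / scale g B ^ n : ℝ) : ℂ) := by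
  rw [rescaled, smul_pow, smul_apply, inner_smul_right, inner_hamiltonian_pow]
  push_cast
  rw [inv_pow, mul_comm, div_eq_mul_inv]

section MeanMoment

variable {B : ℝ} (μ : Measure (Set.Icc (-B) B)) [IsProbabilityMeasure μ]

instance : IsProbabilityMeasure (law μ) := by
  unfold law; infer_instance

/-- The averaged moments. -/
def meanMoment (n : ℕ) : ℝ := ∫ ω, moment n ω ∂(law μ)

/-- The density of states functional in terms of the averaged moments. -/
theorem hasSum_dosFunctional {g : ℝ} (hg : 0 < g) (hB : 0 ≤ B) {f : ℂ → ℂ}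
    (hf : DiffContOnCl ℂ f (Metric.ball 0 1)) :
    HasSum (fun n => taylorCoeff f n * ((meanMoment μ n / scale g B ^ n : ℝ) : ℂ))
      (dosFunctional g μ f) := by
  have hlt := two_add_lt_scale hg B
  have hs : 0 < scale g B := by linarith
  have hq0 : 0 ≤ (2 + B) / scale g B := by positivity
  have hq1 : (2 + B) / scale g B < 1 := (div_lt_one hs).2 hlt
  have hm : ∀ (ω : ℤ → Set.Icc (-B) B) (n : ℕ),
      ‖((moment n ω / scale g B ^ n : ℝ) : ℂ)‖ ≤ ((2 + B) / scale g B) ^ n := fun ω n => by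
    rw [Complex.norm_real, Real.norm_eq_abs, abs_div, abs_of_pos (pow_pos hs n), div_pow]
    gcongr
    exact abs_moment_le hB n ω
  have hle : ∀ (ω : ℤ → Set.Icc (-B) B) (n : ℕ),
      ‖taylorCoeff f n * ((moment n ω / scale g B ^ n : ℝ) : ℂ)‖ ≤
        ‖taylorCoeff f n‖ * ((2 + B) / scale g B) ^ n := fun ω n => by
    rw [norm_mul]; gcongr; exact hm ω n
  have hmeas : ∀ n, Measurable fun ω : ℤ → Set.Icc (-B) B =>
      taylorCoeff f n * ((moment n ω / scale g B ^ n : ℝ) : ℂ) := fun n =>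
    measurable_const.mul (Complex.measurable_ofReal.comp ((measurable_moment B n).div_const _))
  have hsum := hasSum_integral_of_summable_integral_norm (μ := law μ)
    (F := fun n ω => taylorCoeff f n * ((moment n ω / scale g B ^ n : ℝ) : ℂ))
    (fun n => Integrable.of_bound (hmeas n).aestronglyMeasurable _
      (ae_of_all _ fun ω => hle ω n))
    (Summable.of_nonneg_of_le (fun n => integral_nonneg fun _ => norm_nonneg _) (fun n => by
      have := norm_integral_le_of_norm_le_const (μ := law μ)
        (f := fun ω => ‖taylorCoeff f n * ((moment n ω / scale g B ^ n : ℝ) : ℂ)‖)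
        (ae_of_all _ fun ω => by rw [norm_norm]; exact hle ω n)
      simpa using (Real.le_norm_self _).trans this) (summable_norm_taylorCoeff hf.1 hq0 hq1))
  have e1 : (∫ ω, ∑' n, taylorCoeff f n * ((moment n ω / scale g B ^ n : ℝ) : ℂ) ∂(law μ)) =
      dosFunctional g μ f := by
    refine integral_congr_ae (ae_of_all _ fun ω => ?_)
    have := hasSum_inner_calculus hf (norm_rescaled_le g hB ω) (basisVec 0) (basisVec 0) hq0 hq1
      fun n => by rw [inner_rescaled_pow]; exact hm ω n
    simpa only [inner_rescaled_pow] using this.tsum_eq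
  rw [e1] at hsum
  refine hsum.congr_fun fun n => ?_
  rw [integral_const_mul, integral_complex_ofReal, integral_div, meanMoment]

end MeanMoment

theorem isSelfAdjoint_hamiltonian_zero {B : ℝ} (ω : ℤ → Set.Icc (-B) B) :
    IsSelfAdjoint (hamiltonian 0 ω) := by
  have h1 : ∀ m, star (shift m) = shift (-m) := fun m => by
    rw [ContinuousLinearMap.star_eq_adjoint, eq_comm, ContinuousLinearMap.eq_adjoint_iff]
    intro u v
    rw [lp.inner_eq_tsum, lp.inner_eq_tsum, ← (Equiv.subRight m).tsum_eq]
    simp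
  have h2 : star (potential ω) = potential ω := by
    rw [ContinuousLinearMap.star_eq_adjoint, eq_comm, ContinuousLinearMap.eq_adjoint_iff]
    intro u v
    rw [lp.inner_eq_tsum, lp.inner_eq_tsum]
    refine tsum_congr fun k => ?_
    simp only [potential_apply, RCLike.inner_apply, map_mul, Complex.conj_ofReal]
    ring
  rw [IsSelfAdjoint, hamiltonian]
  simp only [star_add, h1, h2, neg_zero, neg_neg, Real.exp_zero, Complex.ofReal_one,
    one_smul]
  abel

theorem spectrum_hamiltonian_zero_subset {B : ℝ} (hB : 0 ≤ B) (ω : ℤ → Set.Icc (-B) B) :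
    spectrum ℝ (hamiltonian 0 ω) ⊆ Set.Icc (-(2 + B)) (2 + B) := fun x hx => by
  have : Nontrivial EllTwo := ⟨basisVec 0, 0, fun h => by simpa [h] using norm_basisVec 0⟩
  have h := (spectrum.norm_le_norm_of_mem hx).trans (norm_hamiltonian_le 0 hB ω)
  rwa [scale_zero, Real.norm_eq_abs, abs_le] at h

/-- The diagonal matrix element `⟨φ_0, f(H_ω(0)) φ_0⟩`. -/
def diagonalElement {B : ℝ} (f : ℝ → ℝ) (ω : ℤ → Set.Icc (-B) B) : ℝ :=
  (inner ℂ (basisVec 0) (selfAdjointCalculus f (hamiltonian 0 ω) (basisVec 0))).re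

theorem ofReal_diagonalElement {B : ℝ} (f : ℝ → ℝ) (ω : ℤ → Set.Icc (-B) B) :
    (diagonalElement f ω : ℂ) =
      inner ℂ (basisVec 0) (selfAdjointCalculus f (hamiltonian 0 ω) (basisVec 0)) := by
  have h : IsSelfAdjoint (selfAdjointCalculus f (hamiltonian 0 ω)) := cfc_predicate _ _
  rw [diagonalElement, ← Complex.conj_eq_iff_re, inner_conj_symm]
  conv_rhs => rw [← h.star_eq, ContinuousLinearMap.star_eq_adjoint,
    ContinuousLinearMap.adjoint_inner_right]

theorem abs_diagonalElement_le {B : ℝ} (hB : 0 ≤ B) {f : ℝ → ℝ} {C : ℝ}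
    (hC : ∀ x ∈ Set.Icc (-(2 + B)) (2 + B), |f x| ≤ C) (ω : ℤ → Set.Icc (-B) B) :
    |diagonalElement f ω| ≤ C := by
  have h0 : 0 ≤ C := (abs_nonneg _).trans (hC 0 ⟨by linarith, by linarith⟩)
  have h1 : ‖selfAdjointCalculus f (hamiltonian 0 ω)‖ ≤ C :=
    norm_cfc_le h0 fun x hx => hC x (spectrum_hamiltonian_zero_subset hB ω hx)
  refine (Complex.abs_re_le_norm _).trans ((norm_inner_le_norm _ _).trans ?_)
  rw [norm_basisVec, one_mul]
  refine (ContinuousLinearMap.le_of_opNorm_le _ h1 _).trans_eq ?_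
  rw [norm_basisVec, mul_one]

theorem diagonalElement_congr {B : ℝ} (hB : 0 ≤ B) {f g : ℝ → ℝ}
    (h : Set.EqOn f g (Set.Icc (-(2 + B)) (2 + B))) (ω : ℤ → Set.Icc (-B) B) :
    diagonalElement f ω = diagonalElement g ω := by
  have e : selfAdjointCalculus f (hamiltonian 0 ω) = selfAdjointCalculus g (hamiltonian 0 ω) :=
    cfc_congr (h.mono (spectrum_hamiltonian_zero_subset hB ω))
  rw [diagonalElement, e, diagonalElement]

theorem diagonalElement_nonneg {B : ℝ} {f : ℝ → ℝ}
    (h : ∀ x, 0 ≤ f x) (ω : ℤ → Set.Icc (-B) B) : 0 ≤ diagonalElement f ω := by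
  have h1 : 0 ≤ selfAdjointCalculus f (hamiltonian 0 ω) := cfc_nonneg fun x _ => h x
  rw [ContinuousLinearMap.nonneg_iff_isPositive] at h1
  exact h1.re_inner_nonneg_right (basisVec 0)

theorem diagonalElement_add {B : ℝ} {f g : ℝ → ℝ} (hf : Continuous f) (hg : Continuous g)
    (ω : ℤ → Set.Icc (-B) B) :
    diagonalElement (fun x => f x + g x) ω = diagonalElement f ω + diagonalElement g ω := by
  rw [diagonalElement, selfAdjointCalculus, cfc_add _ f g hf.continuousOn hg.continuousOn,
    add_apply, inner_add_right, Complex.add_re]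
  rfl

theorem diagonalElement_smul {B : ℝ} {f : ℝ → ℝ} (hf : Continuous f) (c : ℝ)
    (ω : ℤ → Set.Icc (-B) B) :
    diagonalElement (fun x => c * f x) ω = c * diagonalElement f ω := by
  rw [diagonalElement, selfAdjointCalculus, cfc_const_mul c f _ hf.continuousOn,
    smul_apply, ← Complex.coe_smul, inner_smul_right, Complex.re_ofReal_mul]
  rfl

theorem diagonalElement_pow {B : ℝ} (n : ℕ) (ω : ℤ → Set.Icc (-B) B) :
    diagonalElement (fun x => x ^ n) ω = moment n ω := by
  rw [diagonalElement, selfAdjointCalculus,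
    cfc_pow_id _ n (isSelfAdjoint_hamiltonian_zero ω), inner_hamiltonian_pow, Complex.ofReal_re]

theorem measurable_diagonalElement_polynomial (B : ℝ) (p : Polynomial ℝ) :
    Measurable fun ω : ℤ → Set.Icc (-B) B => diagonalElement (fun x => p.eval x) ω := by
  induction p using Polynomial.induction_on' with
  | add p q hp hq =>
    simp only [Polynomial.eval_add, diagonalElement_add p.continuous q.continuous]
    exact hp.add hq
  | monomial n a =>
    simp only [Polynomial.eval_monomial, diagonalElement_smul (continuous_pow n),
      diagonalElement_pow]
    exact measurable_const.mul (measurable_moment B n)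

theorem measurable_diagonalElement {B : ℝ} (hB : 0 ≤ B) {f : ℝ → ℝ} (hf : Continuous f) :
    Measurable fun ω : ℤ → Set.Icc (-B) B => diagonalElement f ω := by
  have hp : ∀ n : ℕ, ∃ p : Polynomial ℝ,
      ∀ x ∈ Set.Icc (-(2 + B)) (2 + B), |p.eval x - f x| < 1 / ((n : ℝ) + 1) := fun n =>
    exists_polynomial_near_of_continuousOn _ _ f hf.continuousOn _ Nat.one_div_pos_of_nat
  choose p hp using hp
  refine measurable_of_tendsto_metrizable (fun n => measurable_diagonalElement_polynomial B (p n))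
    (tendsto_pi_nhds.2 fun ω => ?_)
  rw [tendsto_iff_norm_sub_tendsto_zero]
  refine squeeze_zero (fun _ => norm_nonneg _) (fun n => ?_) tendsto_one_div_add_atTop_nhds_zero_nat
  have h1 : diagonalElement (fun x => (p n).eval x) ω =
      diagonalElement (fun x => (p n).eval x - f x) ω + diagonalElement f ω := by
    rw [← diagonalElement_add (f := fun x => (p n).eval x - f x) ((p n).continuous.sub hf) hf]
    simp
  rw [h1, add_sub_cancel_right]
  exact abs_diagonalElement_le hB (fun x hx => (hp n x hx).le) ω

theorem integrable_diagonalElement {B : ℝ} (hB : 0 ≤ B) (μ : Measure (Set.Icc (-B) B))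
    [IsProbabilityMeasure μ] {f : ℝ → ℝ} (hf : Continuous f) :
    Integrable (fun ω => diagonalElement f ω) (law μ) := by
  obtain ⟨C, hC⟩ := (isCompact_Icc (a := -(2 + B)) (b := 2 + B)).exists_bound_of_continuousOn
    hf.continuousOn
  exact Integrable.of_bound (measurable_diagonalElement hB hf).aestronglyMeasurable C
    (ae_of_all _ fun ω => abs_diagonalElement_le hB hC ω)

theorem isDensityOfStates_iff {B : ℝ} {μ : Measure (Set.Icc (-B) B)} {k : Measure ℝ} :
    IsDensityOfStates μ k ↔ IsLocallyFiniteMeasure k ∧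
      ∀ f : ℝ → ℝ, Continuous f → HasCompactSupport f →
        ∫ x, f x ∂k = ∫ ω, diagonalElement f ω ∂(law μ) := by
  have h : ∀ f : ℝ → ℝ, (∫ ω, inner ℂ (basisVec 0)
      (selfAdjointCalculus f (hamiltonian 0 ω) (basisVec 0)) ∂(law μ)) =
      ((∫ ω, diagonalElement f ω ∂(law μ) : ℝ) : ℂ) := fun f => by
    rw [← integral_complex_ofReal]
    simp only [ofReal_diagonalElement]
  constructor
  · intro hk
    refine ⟨hk.locallyFinite, fun f hf hc => ?_⟩
    have := hk.repr f hf hc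
    rw [h] at this
    exact_mod_cast this
  · rintro ⟨h1, h2⟩
    refine ⟨h1, fun f hf hc => ?_⟩
    rw [h, h2 f hf hc]

open CompactlySupported in
/-- The positive functional `f ↦ 𝔼 ⟨φ_0, f(H_ω(0)) φ_0⟩`. -/
def meanDiagonalElement {B : ℝ} (hB : 0 ≤ B) (μ : Measure (Set.Icc (-B) B))
    [IsProbabilityMeasure μ] : C_c(ℝ, ℝ) →ₚ[ℝ] ℝ :=
  PositiveLinearMap.mk₀
    { toFun := fun f => ∫ ω, diagonalElement f ω ∂(law μ)
      map_add' := fun f g => by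
        refine Eq.trans (integral_congr_ae (ae_of_all _ fun ω =>
          diagonalElement_add f.continuous g.continuous ω)) ?_
        exact integral_add (integrable_diagonalElement hB μ f.continuous)
          (integrable_diagonalElement hB μ g.continuous)
      map_smul' := fun c f => by
        rw [RingHom.id_apply, smul_eq_mul, ← integral_const_mul]
        exact integral_congr_ae (ae_of_all _ fun ω => diagonalElement_smul f.continuous c ω) }
    fun f hf => integral_nonneg fun ω => diagonalElement_nonneg (fun x => hf x) ω

theorem existsUnique_isDensityOfStates {B : ℝ} (hB : 0 ≤ B) (μ : Measure (Set.Icc (-B) B))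
    [IsProbabilityMeasure μ] : ∃! k : Measure ℝ, IsDensityOfStates μ k := by
  simp only [isDensityOfStates_iff]
  refine ⟨RealRMK.rieszMeasure (meanDiagonalElement hB μ), ⟨inferInstance, fun f hf hc => ?_⟩,
    fun k hk => ?_⟩
  · exact RealRMK.integral_rieszMeasure (meanDiagonalElement hB μ) ⟨⟨f, hf⟩, hc⟩
  · have := hk.1
    refine Measure.ext_of_integral_eq_on_compactlySupported fun f => ?_
    rw [hk.2 f f.continuous f.hasCompactSupport]
    exact (RealRMK.integral_rieszMeasure (meanDiagonalElement hB μ) f).symm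

section Support

variable {B : ℝ} {μ : Measure (Set.Icc (-B) B)} {k : Measure ℝ}

theorem IsDensityOfStates.ae_mem_Icc (hB : 0 ≤ B) (hk : IsDensityOfStates μ k) :
    ∀ᵐ x ∂k, x ∈ Set.Icc (-(2 + B)) (2 + B) := by
  obtain ⟨h1, h2⟩ := isDensityOfStates_iff.1 hk
  have key : ∀ n : ℕ, ∀ᵐ x ∂k, ¬ (2 + B < |x| ∧ |x| < n) := fun n => by
    let f : ℝ → ℝ := fun x => max 0 (min (|x| - (2 + B)) (n - |x|))
    have hf : Continuous f := by fun_prop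
    have hc : HasCompactSupport f := by
      refine HasCompactSupport.intro (isCompact_Icc (a := -(n : ℝ)) (b := n)) fun x hx => ?_
      have : (n : ℝ) - |x| ≤ 0 := by
        by_contra h
        exact hx (abs_le.1 (by linarith))
      exact max_eq_left ((min_le_right _ _).trans this)
    have h0 : ∫ x, f x ∂k = 0 := by
      rw [h2 f hf hc]
      refine integral_eq_zero_of_ae (ae_of_all _ fun ω => ?_)
      have := abs_diagonalElement_le hB (f := f) (C := 0) (fun x hx => ?_) ω
      · simpa using this
      · have hx' : |x| - (2 + B) ≤ 0 := by linarith [abs_le.2 hx]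
        rw [show f x = 0 from max_eq_left ((min_le_left _ _).trans hx'), abs_zero]
    have hz := (integral_eq_zero_iff_of_nonneg (fun x => le_max_left _ _)
      (hf.integrable_of_hasCompactSupport hc)).1 h0
    filter_upwards [hz] with x hx hx'
    have : f x > 0 := lt_max_of_lt_right (lt_min (by linarith) (by linarith))
    exact this.ne' hx
  filter_upwards [ae_all_iff.2 key] with x hx
  obtain ⟨n, hn⟩ := exists_nat_gt |x|
  rw [Set.mem_Icc, ← abs_le]
  by_contra h
  exact hx n ⟨not_le.1 h, hn⟩

theorem IsDensityOfStates.setIntegral_pow [IsProbabilityMeasure μ] (hB : 0 ≤ B)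
    (hk : IsDensityOfStates μ k) (n : ℕ) :
    ∫ x in Set.Icc (-(2 + B)) (2 + B), x ^ n ∂k = meanMoment μ n := by
  obtain ⟨h1, h2⟩ := isDensityOfStates_iff.1 hk
  obtain ⟨χ, hχ1, -, hχc, -⟩ := exists_continuous_one_zero_of_isCompact
    (isCompact_Icc (a := -(2 + B)) (b := 2 + B)) isClosed_empty (Set.disjoint_empty _)
  have he : Set.EqOn (fun x => χ x * x ^ n) (fun x => x ^ n) (Set.Icc (-(2 + B)) (2 + B)) :=
    fun x hx => by simp [hχ1 hx]
  rw [← setIntegral_congr_fun measurableSet_Icc he,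
    Measure.restrict_eq_self_of_ae_mem (hk.ae_mem_Icc hB),
    h2 (fun x => χ x * x ^ n) (by fun_prop) hχc.mul_right, meanMoment]
  refine integral_congr_ae (ae_of_all _ fun ω => ?_)
  exact (diagonalElement_congr hB he ω).trans (diagonalElement_pow n ω)

end Support

theorem isOpen_slitPlane (R : ℝ) : IsOpen (slitPlane R) := by
  have h : IsClosed {z : ℂ | z.im = 0 ∧ R ≤ |z.re|} :=
    (isClosed_eq Complex.continuous_im continuous_const).inter
      (isClosed_le continuous_const Complex.continuous_re.abs)
  exact h.isOpen_compl

theorem starConvex_slitPlane {R : ℝ} (hR : 0 < R) : StarConvex ℝ 0 (slitPlane R) := by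
  rw [starConvex_zero_iff]
  intro z hz t h0 h1 h
  simp only [Complex.smul_im, Complex.smul_re, smul_eq_mul, abs_mul, abs_of_nonneg h0] at h
  rcases mul_eq_zero.1 h.1 with ht | hi
  · rw [ht, zero_mul] at h; linarith [h.2]
  · exact hz ⟨hi, h.2.trans (mul_le_of_le_one_left (abs_nonneg _) h1)⟩

theorem ball_subset_slitPlane (R : ℝ) : Metric.ball (0 : ℂ) R ⊆ slitPlane R := fun z hz h => by
  rw [mem_ball_zero_iff] at hz
  linarith [h.2, Complex.abs_re_le_norm z]

theorem one_sub_mul_div_ne_zero {R s : ℝ} (_hR : 0 < R) (hs : 0 < s) {z : ℂ}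
    (hz : z ∈ slitPlane (s / R)) {x : ℝ} (hx : x ∈ Set.Icc (-R) R) :
    1 - z * (x : ℂ) / (s : ℂ) ≠ 0 := by
  intro h
  have hs' : (s : ℂ) ≠ 0 := Complex.ofReal_ne_zero.2 hs.ne'
  have h1 : z * (x : ℂ) = s := by
    rw [sub_eq_zero, eq_div_iff hs', one_mul] at h
    exact h.symm
  have hx0 : x ≠ 0 := fun h0 => hs' (by rw [← h1, h0, Complex.ofReal_zero, mul_zero])
  have h2 : z = ((s / x : ℝ) : ℂ) := by
    rw [Complex.ofReal_div, eq_div_iff (Complex.ofReal_ne_zero.2 hx0), h1]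
  refine hz ⟨by rw [h2, Complex.ofReal_im], ?_⟩
  rw [h2, Complex.ofReal_re, abs_div, abs_of_pos hs]
  have := abs_pos.2 hx0
  gcongr
  exact abs_le.2 hx

/-- The resolvent transform `z ↦ ∫_{[-R, R]} dk(x) / (1 - z x / s)`. -/
def resolventTransform (R s : ℝ) (k : Measure ℝ) (z : ℂ) : ℂ :=
  ∫ x in Set.Icc (-R) R, 1 / (1 - z * (x : ℂ) / (s : ℂ)) ∂k

theorem integrableOn_resolvent {R s : ℝ} (hR : 0 < R) (hs : 0 < s) (k : Measure ℝ)
    [IsLocallyFiniteMeasure k]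
    {z : ℂ} (hz : z ∈ slitPlane (s / R)) :
    IntegrableOn (fun x : ℝ => 1 / (1 - z * (x : ℂ) / (s : ℂ))) (Set.Icc (-R) R) k := by
  refine ContinuousOn.integrableOn_compact isCompact_Icc ?_
  exact continuousOn_const.div (by fun_prop) fun x hx => one_sub_mul_div_ne_zero hR hs hz hx

theorem differentiableOn_resolventTransform {R s : ℝ} (hR : 0 < R) (hs : 0 < s) (k : Measure ℝ)
    [IsLocallyFiniteMeasure k] :
    DifferentiableOn ℂ (resolventTransform R s k) (slitPlane (s / R)) := by
  intro z₀ hz₀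
  obtain ⟨ε, hε, hball⟩ := Metric.nhds_basis_closedBall.mem_iff.1
    ((isOpen_slitPlane (s / R)).mem_nhds hz₀)
  let F' : ℂ → ℝ → ℂ := fun z x => (x : ℂ) / (s : ℂ) / (1 - z * (x : ℂ) / (s : ℂ)) ^ 2
  have hc : ContinuousOn (fun p : ℂ × ℝ => F' p.1 p.2)
      (Metric.closedBall z₀ ε ×ˢ Set.Icc (-R) R) :=
    ContinuousOn.div (by fun_prop) (by fun_prop) fun p hp =>
      pow_ne_zero 2 (one_sub_mul_div_ne_zero hR hs (hball hp.1) hp.2)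
  obtain ⟨C, hC⟩ := ((isCompact_closedBall z₀ ε).prod isCompact_Icc).exists_bound_of_continuousOn hc
  have hfin : IsFiniteMeasure (k.restrict (Set.Icc (-R) R)) :=
    isFiniteMeasure_restrict.2 isCompact_Icc.measure_lt_top.ne
  have hmem := ae_restrict_mem (μ := k) (measurableSet_Icc (a := -R) (b := R))
  refine (hasDerivAt_integral_of_dominated_loc_of_deriv_le (μ := k.restrict (Set.Icc (-R) R))
    (F := fun z x => 1 / (1 - z * (x : ℂ) / (s : ℂ))) (F' := F') (bound := fun _ => C)
    (Metric.ball_mem_nhds z₀ hε) ?_ (integrableOn_resolvent hR hs k hz₀) ?_ ?_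
    (integrable_const C) ?_).2.differentiableAt.differentiableWithinAt
  · filter_upwards [(isOpen_slitPlane (s / R)).mem_nhds hz₀] with z hz
    exact (integrableOn_resolvent hR hs k hz).aestronglyMeasurable
  · refine Measurable.aestronglyMeasurable ?_
    fun_prop
  · filter_upwards [hmem] with x hx z hz
    exact hC (z, x) ⟨Metric.ball_subset_closedBall hz, hx⟩
  · filter_upwards [hmem] with x hx z hz
    have hne := one_sub_mul_div_ne_zero hR hs (hball (Metric.ball_subset_closedBall hz)) hx
    have h1 : HasDerivAt (fun z : ℂ => 1 - z * (x : ℂ) / (s : ℂ)) (-((x : ℂ) / s)) z := by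
      simpa [mul_div_assoc] using ((hasDerivAt_id z).mul_const ((x : ℂ) / s)).const_sub 1
    simpa [F', one_div] using h1.fun_inv hne

theorem hasSum_resolventTransform {R s : ℝ} (hR : 0 < R) (hs : 0 < s) (k : Measure ℝ)
    [IsLocallyFiniteMeasure k] {z : ℂ} (hz : z ∈ Metric.ball (0 : ℂ) (s / R)) :
    HasSum (fun n => (((∫ x in Set.Icc (-R) R, x ^ n ∂k) / s ^ n : ℝ) : ℂ) * z ^ n)
      (resolventTransform R s k z) := by
  have hfin : IsFiniteMeasure (k.restrict (Set.Icc (-R) R)) :=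
    isFiniteMeasure_restrict.2 isCompact_Icc.measure_lt_top.ne
  have hmem := ae_restrict_mem (μ := k) (measurableSet_Icc (a := -R) (b := R))
  set q := ‖z‖ * R / s with hq
  have hq0 : 0 ≤ q := by positivity
  have hq1 : q < 1 := by
    rw [mem_ball_zero_iff, lt_div_iff₀ hR] at hz
    exact (div_lt_one hs).2 hz
  have hle : ∀ x ∈ Set.Icc (-R) R, ‖z * (x : ℂ) / s‖ ≤ q := fun x hx => by
    rw [norm_div, norm_mul, Complex.norm_real, Complex.norm_real, Real.norm_eq_abs,
      Real.norm_of_nonneg hs.le, hq]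
    gcongr
    exact abs_le.2 hx
  have hb : ∀ n : ℕ, ∀ᵐ x : ℝ ∂(k.restrict (Set.Icc (-R) R)), ‖(z * (x : ℂ) / s) ^ n‖ ≤ q ^ n :=
    fun n => by
      filter_upwards [hmem] with x hx
      rw [norm_pow]
      gcongr
      exact hle x hx
  have hsum := hasSum_integral_of_summable_integral_norm (μ := k.restrict (Set.Icc (-R) R))
    (F := fun (n : ℕ) (x : ℝ) => (z * (x : ℂ) / s) ^ n)
    (fun n => Integrable.of_bound (by fun_prop) (q ^ n) (hb n))
    (Summable.of_nonneg_of_le (fun n => integral_nonneg fun _ => norm_nonneg _) (fun n => by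
      have := norm_integral_le_of_norm_le_const (μ := k.restrict (Set.Icc (-R) R))
        (f := fun x : ℝ => ‖(z * (x : ℂ) / s) ^ n‖) (by simpa only [norm_norm] using hb n)
      exact (Real.le_norm_self _).trans this)
      ((summable_geometric_of_lt_one hq0 hq1).mul_right _))
  have e : ∫ x in Set.Icc (-R) R, ∑' n : ℕ, (z * (x : ℂ) / s) ^ n ∂k =
      resolventTransform R s k z := by
    refine integral_congr_ae ?_
    filter_upwards [hmem] with x hx
    rw [tsum_geometric_of_norm_lt_one ((hle x hx).trans_lt hq1), one_div]
  rw [e] at hsum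
  refine hsum.congr_fun fun n => ?_
  have e1 : ∀ x : ℝ, (z * (x : ℂ) / s) ^ n = z ^ n / (s : ℂ) ^ n * ((x ^ n : ℝ) : ℂ) := fun x => by
    push_cast; rw [div_pow, mul_pow]; ring
  simp only [e1]
  rw [integral_const_mul, integral_complex_ofReal]
  push_cast
  ring

theorem hasSum_circleAverage_mul_conj {f ψ : ℂ → ℂ} {a : ℕ → ℂ}
    (hf : ContinuousOn f (Metric.sphere 0 1)) (ha : Summable fun n => ‖a n‖)
    (hψ : ∀ z : ℂ, ‖z‖ = 1 → HasSum (fun n => a n * z ^ n) (ψ z)) :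
    HasSum (fun n => Real.circleAverage (fun z => f z * conj z ^ n) 0 1 * conj (a n))
      (Real.circleAverage (fun z => f z * conj (ψ z)) 0 1) := by
  obtain ⟨C, hC⟩ := (isCompact_sphere (0 : ℂ) 1).exists_bound_of_continuousOn hf
  have hcm : Continuous fun t : ℝ => f (circleMap 0 1 t) :=
    hf.comp_continuous (continuous_circleMap 0 1) fun t => circleMap_mem_sphere 0 zero_le_one t
  have hn : ∀ t : ℝ, ‖circleMap 0 1 t‖ = 1 := fun t => by simp
  have h := intervalIntegral.hasSum_integral_of_dominated_convergence (μ := volume)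
    (a := 0) (b := 2 * Real.pi)
    (F := fun (n : ℕ) (t : ℝ) => f (circleMap 0 1 t) * conj (circleMap 0 1 t) ^ n * conj (a n))
    (f := fun t => f (circleMap 0 1 t) * conj (ψ (circleMap 0 1 t)))
    (fun n _ => C * ‖a n‖)
    (fun n => ((hcm.mul ((Complex.continuous_conj.comp (continuous_circleMap 0 1)).pow n)).mul
      continuous_const).aestronglyMeasurable)
    (fun n => ae_of_all _ fun t _ => by
      rw [norm_mul, norm_mul, norm_pow, RCLike.norm_conj, RCLike.norm_conj, hn, one_pow, mul_one]
      gcongr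
      exact hC _ (circleMap_mem_sphere 0 zero_le_one t))
    (ae_of_all _ fun t _ => ha.mul_left C)
    (by simp)
    (ae_of_all _ fun t _ => by
      have h1 := (Complex.hasSum_conj'.2 (hψ _ (hn t))).mul_left (f (circleMap 0 1 t))
      refine h1.congr_fun fun n => ?_
      simp only [map_mul, map_pow]
      ring)
  refine (h.const_smul ((2 * Real.pi)⁻¹)).congr_fun fun n => ?_
  rw [intervalIntegral.integral_mul_const, Real.circleAverage, smul_mul_assoc]

theorem diffContOnCl_pow (n : ℕ) : DiffContOnCl ℂ (fun z : ℂ => z ^ n) (Metric.ball 0 1) :=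
  (differentiable_pow n).diffContOnCl

theorem taylorCoeff_pow (n : ℕ) : taylorCoeff (fun z => z ^ n) = Pi.single n 1 := by
  ext m
  refine taylorCoeff_of_hasSum one_pos (fun z _ => ?_) m
  have := hasSum_single (f := fun m => (Pi.single n 1 : ℕ → ℂ) m * z ^ m) n fun m hm => by
    simp [hm]
  simpa using this

variable {g B : ℝ} {μ : Measure (Set.Icc (-B) B)} [IsProbabilityMeasure μ]

theorem dosFunctional_pow (hg : 0 < g) (hB : 0 ≤ B) (n : ℕ) :
    dosFunctional g μ (fun z => z ^ n) = ((meanMoment μ n / scale g B ^ n : ℝ) : ℂ) := by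
  have h := hasSum_dosFunctional μ hg hB (diffContOnCl_pow n)
  rw [taylorCoeff_pow] at h
  refine h.unique ?_
  have := hasSum_single (f := fun m => (Pi.single n 1 : ℕ → ℂ) m *
    ((meanMoment μ m / scale g B ^ m : ℝ) : ℂ)) n fun m hm => by simp [hm]
  simpa using this

theorem IsSymbol.taylorCoeff_eq (hg : 0 < g) (hB : 0 ≤ B) {r : ℝ} {ψ : ℂ → ℂ}
    (h : IsSymbol g μ r ψ) (n : ℕ) :
    taylorCoeff ψ n = ((meanMoment μ n / scale g B ^ n : ℝ) : ℂ) := by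
  have hd : DiffContOnCl ℂ ψ (Metric.ball 0 1) :=
    (h.holo.mono (Metric.closure_ball_subset_closedBall.trans
      (Metric.closedBall_subset_ball ((one_lt_inv₀ h.pos).2 h.lt_one)))).diffContOnCl
  have h1 := h.repr _ (diffContOnCl_pow n)
  rw [circleAverage_pow_mul_conj hd, dosFunctional_pow hg hB] at h1
  rw [← Complex.conj_conj (taylorCoeff ψ n), ← h1, Complex.conj_ofReal]

theorem IsSymbol.hasSum (hg : 0 < g) (hB : 0 ≤ B) {r : ℝ} {ψ : ℂ → ℂ}
    (h : IsSymbol g μ r ψ) {z : ℂ} (hz : z ∈ Metric.ball (0 : ℂ) r⁻¹) :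
    HasSum (fun n => ((meanMoment μ n / scale g B ^ n : ℝ) : ℂ) * z ^ n) (ψ z) := by
  simpa only [h.taylorCoeff_eq hg hB] using hasSum_taylorCoeff h.holo hz

theorem IsDensityOfStates.hasSum_resolventTransform (hg : 0 < g) (hB : 0 ≤ B) {k : Measure ℝ}
    (hk : IsDensityOfStates μ k) {z : ℂ} (hz : z ∈ Metric.ball (0 : ℂ) (scale g B / (2 + B))) :
    HasSum (fun n => ((meanMoment μ n / scale g B ^ n : ℝ) : ℂ) * z ^ n)
      (resolventTransform (2 + B) (scale g B) k z) := by
  have := hk.locallyFinite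
  have hs := two_add_lt_scale hg B
  simpa only [hk.setIntegral_pow hB] using
    NSAnderson.hasSum_resolventTransform (by linarith) (by linarith) k hz

theorem IsDensityOfStates.isSymbol_resolventTransform (hg : 0 < g) (hB : 0 ≤ B) {k : Measure ℝ}
    (hk : IsDensityOfStates μ k) :
    IsSymbol g μ ((2 + B) / scale g B) (resolventTransform (2 + B) (scale g B) k) := by
  have hs := two_add_lt_scale hg B
  have hs0 : 0 < scale g B := by linarith
  have h1 : 1 < scale g B / (2 + B) := (one_lt_div (by linarith)).2 hs
  have hsum : ∀ z : ℂ, ‖z‖ = 1 → HasSum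
      (fun n => ((meanMoment μ n / scale g B ^ n : ℝ) : ℂ) * z ^ n)
      (resolventTransform (2 + B) (scale g B) k z) := fun z hz =>
    hk.hasSum_resolventTransform hg hB (by rwa [mem_ball_zero_iff, hz])
  refine ⟨by positivity, (div_lt_one hs0).2 hs, ?_, fun f hf => ?_⟩
  · rw [inv_div]
    exact differentiableOn_of_hasSum fun z hz => hk.hasSum_resolventTransform hg hB hz
  · have hc : ContinuousOn f (Metric.sphere 0 1) :=
      (closure_ball (0 : ℂ) one_ne_zero ▸ hf.continuousOn).mono Metric.sphere_subset_closedBall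
    have ha : Summable fun n => ‖((meanMoment μ n / scale g B ^ n : ℝ) : ℂ)‖ := by
      simpa using (hsum 1 (by simp)).summable.norm
    have h := hasSum_circleAverage_mul_conj hc ha hsum
    simp only [circleAverage_mul_conj_pow hf, Complex.conj_ofReal] at h
    exact (hasSum_dosFunctional μ hg hB hf).unique h

theorem IsSymbol.eqOn_resolventTransform (hg : 0 < g) (hB : 0 ≤ B) {k : Measure ℝ} {r : ℝ}
    {ψ : ℂ → ℂ} (hk : IsDensityOfStates μ k) (h : IsSymbol g μ r ψ) :
    Set.EqOn (resolventTransform (2 + B) (scale g B) k) ψ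
      (slitPlane (scale g B / (2 + B)) ∩ Metric.ball 0 r⁻¹) := by
  have := hk.locallyFinite
  have hs := two_add_lt_scale hg B
  have hs0 : 0 < scale g B := by linarith
  have hR : 0 < 2 + B := by linarith
  have hρ : 0 < scale g B / (2 + B) := by positivity
  have hr : 0 < r⁻¹ := inv_pos.2 h.pos
  have h0 : (0 : ℂ) ∈ slitPlane (scale g B / (2 + B)) ∩ Metric.ball 0 r⁻¹ :=
    ⟨ball_subset_slitPlane _ (Metric.mem_ball_self hρ), Metric.mem_ball_self hr⟩
  have hpre : IsPreconnected (slitPlane (scale g B / (2 + B)) ∩ Metric.ball (0 : ℂ) r⁻¹) :=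
    ((starConvex_slitPlane hρ).inter
      ((convex_ball (0 : ℂ) r⁻¹).starConvex (Metric.mem_ball_self hr))).isPathConnected
      h0 |>.isConnected.isPreconnected
  refine AnalyticOnNhd.eqOn_of_preconnected_of_eventuallyEq (z₀ := 0)
    (((differentiableOn_resolventTransform hR hs0 k).analyticOnNhd (isOpen_slitPlane _)).mono
      Set.inter_subset_left)
    ((h.holo.analyticOnNhd Metric.isOpen_ball).mono Set.inter_subset_right) hpre h0 ?_
  filter_upwards [Metric.ball_mem_nhds (0 : ℂ) hρ, Metric.ball_mem_nhds (0 : ℂ) hr] with z h1 h2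
  exact (hk.hasSum_resolventTransform hg hB h1).unique (h.hasSum hg hB h2)

end NSAnderson

end

theorem mainTheorem10 (g B : ℝ) (hg : 0 < g) (hB : Real.exp g + Real.exp (-g) ≤ B)
    (μ : Measure (Set.Icc (-B) B)) [IsProbabilityMeasure μ] :
    -- the density of states measure and the function `ψ` exist
    (∃! k : Measure ℝ, NSAnderson.IsDensityOfStates μ k) ∧
    (∃ ψ : ℂ → ℂ, NSAnderson.IsSymbol g μ ((2 + B) / NSAnderson.scale g B) ψ) ∧
    ∀ (k : Measure ℝ) (r : ℝ) (ψ : ℂ → ℂ),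
      NSAnderson.IsDensityOfStates μ k → NSAnderson.IsSymbol g μ r ψ →
      -- a power series with real coefficients
      (∃ b : ℕ → ℝ,
        (∀ z ∈ Metric.ball (0 : ℂ) (NSAnderson.scale g B / (2 + B)),
          Summable fun n => (b n : ℂ) * z ^ n) ∧
        ∀ z ∈ Metric.ball (0 : ℂ) (NSAnderson.scale g B / (2 + B)) ∩ Metric.ball 0 r⁻¹,
          HasSum (fun n => (b n : ℂ) * z ^ n) (ψ z)) ∧
      -- the analytic continuation
      ∃ Ψ : ℂ → ℂ,
        AnalyticOnNhd ℂ Ψ (NSAnderson.slitPlane (NSAnderson.scale g B / (2 + B))) ∧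
        Set.EqOn Ψ ψ
          (NSAnderson.slitPlane (NSAnderson.scale g B / (2 + B)) ∩ Metric.ball 0 r⁻¹) ∧
        ∀ z ∈ NSAnderson.slitPlane (NSAnderson.scale g B / (2 + B)),
          IntegrableOn (fun x : ℝ => 1 / (1 - z * (x : ℂ) / (NSAnderson.scale g B : ℂ)))
            (Set.Icc (-(2 + B)) (2 + B)) k ∧
          Ψ z = ∫ x in Set.Icc (-(2 + B)) (2 + B),
            1 / (1 - z * (x : ℂ) / (NSAnderson.scale g B : ℂ)) ∂k := by
  have hB0 : 0 ≤ B := by linarith [Real.exp_pos g, Real.exp_pos (-g)]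
  have hs := NSAnderson.two_add_lt_scale hg B
  have hs0 : 0 < NSAnderson.scale g B := by linarith
  have hR : 0 < 2 + B := by linarith
  have hex := NSAnderson.existsUnique_isDensityOfStates hB0 μ
  refine ⟨hex, ?_, fun k r ψ hk hψ => ⟨?_, ?_⟩⟩
  · obtain ⟨k, hk⟩ := hex.exists
    exact ⟨_, hk.isSymbol_resolventTransform hg hB0⟩
  · exact ⟨fun n => NSAnderson.meanMoment μ n / NSAnderson.scale g B ^ n,
      fun z hz => (hk.hasSum_resolventTransform hg hB0 hz).summable,
      fun z hz => hψ.hasSum hg hB0 hz.2⟩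
  · have := hk.locallyFinite
    exact ⟨NSAnderson.resolventTransform (2 + B) (NSAnderson.scale g B) k,
      (NSAnderson.differentiableOn_resolventTransform hR hs0 k).analyticOnNhd
        (NSAnderson.isOpen_slitPlane _),
      hψ.eqOn_resolventTransform hg hB0 hk,
      fun z hz => ⟨NSAnderson.integrableOn_resolvent hR hs0 k hz, rfl⟩⟩
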